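/- Let $a>0$, let $(a)_0=1$, $(a)_n=a(a+1)\cdots(a+n-1)$ for $n\ge1$, put $c_n=(-1)^n(a)_n$, and for $x>0$ let $$F(x)=\frac1{\Gamma(a)}\int_0^\infty \frac{s^{a-1}e^{-s}}{1+xs}\,ds .$$ Then the following hold. 1. The integral converges absolutely for every $x>0$. 2. The series $\sum_{n\ge0}c_nx^n$ diverges for every real $x\ne0$, and it is the asymptotic expansion of $F$ at $0^+$: for every $N\ge0$, $F(x)-\sum_{n<N}c_nx^n=O(x^N)$ as $x\to0^+$. 3. The series is obtained by formally interchanging sum and integral. That is, for every $x>0$, $$F(x)=\frac1{\Gamma(a)}\int_0^\infty\!\!\int_0^\infty s^{a-1}e^{-s}e^{-t(1+xs)}\,dt\,ds$$ with an absolutely integrable integrand; for all $s,t>0$ the integrand equals the convergent sum $\sum_{n\ge0}s^{a-1}e^{-s}e^{-t}\frac{(-txs)^n}{n!}$; and for every $n$ the $n$-th term is absolutely integrable with $$\frac1{\Gamma(a)}\int_0^\infty\!\!\int_0^\infty s^{a-1}e^{-s}e^{-t}\frac{(-txs)^n}{n!}\,dt\,ds=(-1)^n(a)_nx^n .$$ 4.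 Let $\alpha_{2m}=\det(c_{i+j})_{0\le i,j\le m}$ and $\alpha_{2m+1}=\det(c_{i+j+1})_{0\le i,j\le m}$. All $\alpha_n$ are nonzero, and the numbers given by the Muir–Rogers formula $$e_0=\alpha_0,\quad e_1=\frac{\alpha_1}{\alpha_0},\quad e_2=\frac{\alpha_2}{\alpha_1\alpha_0},\quad e_n=\frac{\alpha_n\alpha_{n-3}}{\alpha_{n-1}\alpha_{n-2}}\ (n\ge3)$$ are $e_0=1$, $e_{2m}=-m$ for $m\ge1$, and $e_{2m+1}=-(a+m)$ for $m\ge0$. 5. Consider the continued fraction $$\cfrac{e_0}{1-\cfrac{e_1x}{1-\cfrac{e_2x}{1-\cdots}}}$$ whose $n$-th convergent is the fraction formed with $e_0,\dots,e_{n-1}$ (and is $0$ for $n=0$). As a formal series in $x$ it corresponds to $\sum c_nx^n$: for every $n$ the $n$-th convergent has nonzero denominator, and its expansion at $x=0$ agrees with $\sum_k c_kx^k$ in all degrees less than $n$. 6. For every $x>0$ all denominators of the convergents of this continued fraction are nonzero, and the convergents tend to $F(x)$. -/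

import Mathlib

/-- The coefficients `(-1)^n (a)_n` of the Wallis series, where
`(a)_n = a (a+1) ⋯ (a+n-1)` is the Pochhammer symbol. -/
noncomputable def wallisCoeff (a : ℝ) (n : ℕ) : ℝ :=
  (-1) ^ n * (ascPochhammer ℝ n).eval a

/-- The integrand `s^(a-1) e^(-s) / (1 + x s)`. -/
noncomputable def wallisIntegrand (a x s : ℝ) : ℝ :=
  s ^ (a - 1) * Real.exp (-s) / (1 + x * s)

/-- `Γ(a)⁻¹ ∫₀^∞ s^(a-1) e^(-s) / (1 + x s) ds`. -/
noncomputable def wallisIntegral (a x : ℝ) : ℝ :=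
  1 / Real.Gamma a * ∫ s in Set.Ioi (0 : ℝ), wallisIntegrand a x s

/-- The `n`-th term of the expansion of `s^(a-1) e^(-s) e^(-t(1+xs))` in powers of `x`. -/
noncomputable def wallisTerm (a x : ℝ) (n : ℕ) (s t : ℝ) : ℝ :=
  s ^ (a - 1) * Real.exp (-s) * (Real.exp (-t) * ((-(t * x * s)) ^ n / (n.factorial : ℝ)))

/-- The continued fraction `e₀/(1 - e₁x/(1 - e₂x/(1 - ⋯)))`, with pivot variable `x`,
over an arbitrary field. -/
def pivotContFract {K : Type*} [Field K] (e : ℕ → K) (x : K) : GenContFract K where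
  h := 0
  s := Stream'.Seq.ofStream fun n : ℕ => ⟨if n = 0 then e 0 else -(e n * x), 1⟩

/-- The Hankel determinants `α_n` of Muir and Rogers for a sequence `c`:
`α_{2m} = det (c_{i+j})` and `α_{2m+1} = det (c_{i+j+1})`, with `0 ≤ i, j ≤ m`. -/
noncomputable def muirRogersDet (c : ℕ → ℝ) (n : ℕ) : ℝ :=
  (Matrix.of fun i j : Fin (n / 2 + 1) => c ((i : ℕ) + (j : ℕ) + n % 2)).det

/-- The continued fraction coefficients `e_n` given by the Muir-Rogers formula. -/
noncomputable def muirRogersCoeff (c : ℕ → ℝ) : ℕ → ℝ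
  | 0 => muirRogersDet c 0
  | 1 => muirRogersDet c 1 / muirRogersDet c 0
  | 2 => muirRogersDet c 2 / (muirRogersDet c 1 * muirRogersDet c 0)
  | n + 3 => muirRogersDet c (n + 3) * muirRogersDet c n /
      (muirRogersDet c (n + 2) * muirRogersDet c (n + 1))

/-- The continued fraction with real coefficients `e` and a formal pivot variable `X`,
over the field of formal Laurent series. -/
noncomputable def formalPivotContFract (e : ℕ → ℝ) : GenContFract (LaurentSeries ℝ) :=
  pivotContFract (fun n => HahnSeries.C (e n)) (HahnSeries.single 1 1)

/-! Both the formal and the analytic statement come from one staircase of functions. Put `f p q` =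
Γ(p)⁻¹ ∫ s^(p-1) e^(-s) (1+xs)^(-q) ds, with formal counterpart ₂F₀(p, q; -X). In both settings `f`
obeys two contiguous relations, one raising `q` and one raising `p`. Along (a,0), (a,1), (a+1,1),
(a+1,2), … they become a recurrence G_n = G_(n+1) - e_(n+1) x G_(n+2) with exactly the Muir–Rogers
coefficients, where G_0 = 1 and G_1 is F or its series (`staircase_recurrence`). The coefficients
themselves follow from Hankel determinants that reduce to Vandermonde ones.

With A_n/B_n the convergents, G_1 B_n - A_n = (∏ e_i x) G_(n+1) (`pivotContFract_remainder`).
Formally the right side is divisible by X^n and B_n is a unit: this is correspondence. For x > 0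
everything is positive up to sign and B_(n+1) G_(n+1) ≤ 1, so the error is at most |∏ e_i x| / (B_n
B_(n+1)). This tends to 0 because the e_n grow only linearly, through divergence of the harmonic
series (`tendsto_dens_mul_dens_div_prod`). -/

/-! ### Three-term recurrences of the continued fraction -/

section PivotContFract

variable {K : Type*} [Field K] (e : ℕ → K) (x : K)

theorem pivotContFract_dens_zero : (pivotContFract e x).dens 0 = 1 :=
  GenContFract.zeroth_den_eq_one

theorem pivotContFract_dens_one : (pivotContFract e x).dens 1 = 1 :=
  GenContFract.first_den_eq (gp := ⟨e 0, 1⟩) rfl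

theorem pivotContFract_dens_add_two (n : ℕ) :
    (pivotContFract e x).dens (n + 2) =
      (pivotContFract e x).dens (n + 1) - e (n + 1) * x * (pivotContFract e x).dens n := by
  rw [GenContFract.dens_recurrence (g := pivotContFract e x) (n := n)
    (gp := ⟨-(e (n + 1) * x), 1⟩) rfl rfl rfl]
  ring

theorem pivotContFract_nums_zero : (pivotContFract e x).nums 0 = 0 :=
  GenContFract.zeroth_num_eq_h

theorem pivotContFract_nums_one : (pivotContFract e x).nums 1 = e 0 := by
  rw [GenContFract.first_num_eq (g := pivotContFract e x) (gp := ⟨e 0, 1⟩) rfl]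
  simp [pivotContFract]

theorem pivotContFract_nums_add_two (n : ℕ) :
    (pivotContFract e x).nums (n + 2) =
      (pivotContFract e x).nums (n + 1) - e (n + 1) * x * (pivotContFract e x).nums n := by
  rw [GenContFract.nums_recurrence (g := pivotContFract e x) (n := n)
    (gp := ⟨-(e (n + 1) * x), 1⟩) rfl rfl rfl]
  ring

variable {e x}

/-- The remainder of the `n`-th convergent, in terms of a solution `G` of the three-term
recurrence attached to the continued fraction. -/
theorem pivotContFract_remainder (he : e 0 = 1) {G : ℕ → K}
    (hG : ∀ n, G n = G (n + 1) - e (n + 1) * x * G (n + 2)) (n : ℕ) :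
    G 1 * (pivotContFract e x).dens n - G 0 * (pivotContFract e x).nums n =
      (∏ i ∈ Finset.range n, e (i + 1) * x) * G (n + 1) := by
  induction n using Nat.twoStepInduction with
  | zero => rw [pivotContFract_dens_zero, pivotContFract_nums_zero]; simp
  | one =>
    simp only [pivotContFract_dens_one, pivotContFract_nums_one, he, hG 0, Finset.prod_range_one]
    ring
  | more n ih₀ ih₁ =>
    rw [pivotContFract_dens_add_two, pivotContFract_nums_add_two, Finset.prod_range_succ]
    have h := hG (n + 1)
    rw [Finset.prod_range_succ] at ih₁ ⊢
    linear_combination ih₁ - e (n + 1) * x * ih₀ -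
      (∏ i ∈ Finset.range n, e (i + 1) * x) * (e (n + 1) * x) * h

/-- The left side is independent of `n`, by the two recurrences. When both of its terms are positive
it bounds `dens (n + 1) * G (n + 1)` by `G 0`. -/
theorem pivotContFract_dens_mul {G : ℕ → K}
    (hG : ∀ n, G n = G (n + 1) - e (n + 1) * x * G (n + 2)) (n : ℕ) :
    (pivotContFract e x).dens (n + 1) * G (n + 1) -
      e (n + 1) * x * (pivotContFract e x).dens n * G (n + 2) = G 0 := by
  induction n with
  | zero =>
    rw [hG 0, pivotContFract_dens_zero, pivotContFract_dens_one]
    ring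
  | succ n ih =>
    rw [pivotContFract_dens_add_two]
    linear_combination ih - (pivotContFract e x).dens (n + 1) * hG (n + 1)

end PivotContFract

/-! ### Formal correspondence -/

section Correspondence

/-- Constant term 1 makes the denominator a unit among power series, so division by it preserves the
order of the remainder. -/
theorem formalPivotContFract_dens_mem (e : ℕ → ℝ) (n : ℕ) :
    ∃ b : PowerSeries ℝ, PowerSeries.constantCoeff b = 1 ∧
      (formalPivotContFract e).dens n = HahnSeries.ofPowerSeries ℤ ℝ b := by
  induction n using Nat.twoStepInduction with
  | zero => exact ⟨1, by simp, by simp [formalPivotContFract]⟩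
  | one => exact ⟨1, by simp, by simp [formalPivotContFract, pivotContFract_dens_one]⟩
  | more n ih₀ ih₁ =>
    obtain ⟨b₀, -, h₀⟩ := ih₀
    obtain ⟨b₁, hb₁, h₁⟩ := ih₁
    refine ⟨b₁ - PowerSeries.C (e (n + 1)) * PowerSeries.X * b₀, by simp [hb₁], ?_⟩
    rw [formalPivotContFract] at *
    rw [pivotContFract_dens_add_two, h₀, h₁, map_sub, map_mul, map_mul,
      HahnSeries.ofPowerSeries_C, HahnSeries.ofPowerSeries_X]

/-- If `g` solves the recurrence attached to the formal continued fraction, then the continued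
fraction corresponds to `g 1`. -/
theorem formalPivotContFract_corresponds {e : ℕ → ℝ} (he : e 0 = 1) {g : ℕ → PowerSeries ℝ}
    (hg₀ : g 0 = 1)
    (hg : ∀ n, g n = g (n + 1) - PowerSeries.C (e (n + 1)) * PowerSeries.X * g (n + 2)) (n : ℕ) :
    (formalPivotContFract e).dens n ≠ 0 ∧
      ∀ k : ℤ, k < n → ((formalPivotContFract e).convs n).coeff k =
        (HahnSeries.ofPowerSeries ℤ ℝ (g 1)).coeff k := by
  obtain ⟨b, hb, hd⟩ := formalPivotContFract_dens_mem e n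
  have hb0 : PowerSeries.constantCoeff b ≠ 0 := by simp [hb]
  have hbne : b ≠ 0 := by
    rintro rfl
    simp at hb
  have hne : (formalPivotContFract e).dens n ≠ 0 := by
    rw [hd, Ne, map_eq_zero_iff _ HahnSeries.ofPowerSeries_injective]
    exact hbne
  refine ⟨hne, fun k hk => ?_⟩
  have key := pivotContFract_remainder (K := LaurentSeries ℝ)
    (e := fun n => HahnSeries.C (e n)) (x := HahnSeries.single 1 1)
    (G := fun n => HahnSeries.ofPowerSeries ℤ ℝ (g n)) (by simp [he])
    (fun m => by
      conv_lhs => rw [hg m]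
      rw [map_sub, map_mul, map_mul, HahnSeries.ofPowerSeries_C, HahnSeries.ofPowerSeries_X]) n
  have hprod : (∏ i ∈ Finset.range n,
      (HahnSeries.C (e (i + 1)) * HahnSeries.single 1 1 : LaurentSeries ℝ)) =
      HahnSeries.ofPowerSeries ℤ ℝ
        (PowerSeries.X ^ n * PowerSeries.C (∏ i ∈ Finset.range n, e (i + 1))) := by
    rw [Finset.prod_mul_distrib, Finset.prod_const, Finset.card_range, map_mul, map_pow,
      HahnSeries.ofPowerSeries_C, HahnSeries.ofPowerSeries_X, map_prod, mul_comm]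
  have hconv : (formalPivotContFract e).convs n = HahnSeries.ofPowerSeries ℤ ℝ
      (g 1 - PowerSeries.X ^ n *
        (PowerSeries.C (∏ i ∈ Finset.range n, e (i + 1)) * g (n + 1) * b⁻¹)) := by
    rw [GenContFract.conv_eq_num_div_den, div_eq_iff hne]
    change _ * (formalPivotContFract e).dens n - _ * (formalPivotContFract e).nums n = _ at key
    simp only [hprod, hg₀, map_one, one_mul] at key
    rw [sub_eq_iff_eq_add, ← sub_eq_iff_eq_add'] at key
    rw [← key, hd, ← map_mul, ← map_mul, ← map_mul, ← map_sub]
    congr 1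
    linear_combination PowerSeries.X ^ n *
      (PowerSeries.C (∏ i ∈ Finset.range n, e (i + 1)) * g (n + 1)) *
      PowerSeries.mul_inv_cancel b hb0
  rw [hconv, PowerSeries.coeff_coe, PowerSeries.coeff_coe]
  split_ifs with hk0
  · rfl
  · rw [map_sub, PowerSeries.coeff_X_pow_mul', if_neg (by omega), sub_zero]

end Correspondence

/-! ### Convergence of Stieltjes fractions -/

section Convergence

/-- For a Stieltjes fraction whose partial numerators grow at most linearly, the quantities
`B_n B_{n+1} / (q_0 ⋯ q_{n-1})` controlling the distance of successive convergents diverge. -/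
theorem tendsto_dens_mul_dens_div_prod {B q : ℕ → ℝ} {C : ℝ} (hB₀ : B 0 = 1) (hB₁ : B 1 = 1)
    (hB : ∀ n, B (n + 2) = B (n + 1) + q n * B n) (hq : ∀ n, 0 < q n)
    (hC : 1 ≤ C) (hqC : ∀ n, q n ≤ C * (n + 1)) :
    Filter.Tendsto (fun n => B n * B (n + 1) / ∏ i ∈ Finset.range n, q i)
      Filter.atTop Filter.atTop := by
  have hBpos : ∀ n, 0 < B n := fun n => by
    induction n using Nat.twoStepInduction with
    | zero => simp [hB₀]
    | one => simp [hB₁]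
    | more n ih₀ ih₁ =>
      rw [hB]
      have := hq n
      positivity
  set P : ℕ → ℝ := fun n => ∏ i ∈ Finset.range n, q i with hP
  have hPpos : ∀ n, 0 < P n := fun n => Finset.prod_pos fun i _ => hq i
  have hPs : ∀ n, P (n + 1) = P n * q n := fun n => Finset.prod_range_succ _ _
  set D : ℕ → ℝ := fun n => B n * B (n + 1) / P n with hD
  set u : ℕ → ℝ := fun n => B n ^ 2 / P n with hu
  have hupos : ∀ n, 0 < u n := fun n => div_pos (pow_pos (hBpos n) 2) (hPpos n)
  have hDs : ∀ n, D (n + 1) = D n + u (n + 1) := fun n => by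
    have h1 := (hPpos n).ne'
    have h2 := (hq n).ne'
    simp only [hD, hu, hPs, hB n]
    field_simp
    ring
  have hDsq : ∀ n, D n ^ 2 = u n * u (n + 1) * q n := fun n => by
    have h1 := (hPpos n).ne'
    have h2 := (hq n).ne'
    simp only [hD, hu, hPs]
    field_simp
  have hD1 : ∀ n, 1 ≤ D n := fun n => by
    induction n with
    | zero => simp [hD, hP, hB₀, hB₁]
    | succ n ih =>
      rw [hDs]
      linarith [hupos (n + 1)]
  -- Since `D n ≥ 1`, the product `u n * u (n + 1)` is at least 1/t with t = C(n+1) ≥ 1. Hence the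
  -- sum is at least t^(-1/2) ≥ 1/t.
  have hstep : ∀ n, 1 / (C * (n + 1)) ≤ u n + u (n + 1) := fun n => by
    have hn : (1 : ℝ) ≤ C * (n + 1) := by nlinarith [Nat.cast_nonneg (α := ℝ) n]
    have h1 : 1 ≤ u n * u (n + 1) * (C * (n + 1)) := by
      have h2 : 1 ≤ D n ^ 2 := by nlinarith [hD1 n]
      rw [hDsq] at h2
      exact h2.trans (mul_le_mul_of_nonneg_left (hqC n) (mul_pos (hupos _) (hupos _)).le)
    rw [div_le_iff₀ (by linarith)]
    set t := C * ((n : ℝ) + 1)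
    by_contra! hlt
    have h3 := hupos n
    have h4 := hupos (n + 1)
    have h5 : (u n + u (n + 1)) * t * ((u n + u (n + 1)) * t) < 1 := by
      have : 0 < (u n + u (n + 1)) * t := by positivity
      nlinarith
    have h6 : u n * u (n + 1) * t * t ≤ (u n + u (n + 1)) * t * ((u n + u (n + 1)) * t) := by
      have : 0 ≤ t * t * (u n ^ 2 + u n * u (n + 1) + u (n + 1) ^ 2) := by positivity
      linarith
    nlinarith
  have hlow : ∀ n, 1 / (2 * C) * ∑ i ∈ Finset.range n, (1 / ((i : ℝ) + 1)) ≤ D n + 1 := fun n => by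
    have hsum : ∑ i ∈ Finset.range n, 1 / (C * ((i : ℝ) + 1)) ≤ 2 * D n := by
      -- Summing `hstep` counts each increment `u` of `D` at most twice; the extra `u n` carries the
      -- half not yet used.
      have h : ∑ i ∈ Finset.range n, 1 / (C * ((i : ℝ) + 1)) + u n ≤ 2 * D n := by
        induction n with
        | zero => simp [hD, hu, hP, hB₀, hB₁]
        | succ n ih =>
          rw [Finset.sum_range_succ, hDs]
          linarith [hstep n]
      linarith [hupos n]
    have heq : 1 / (2 * C) * ∑ i ∈ Finset.range n, (1 / ((i : ℝ) + 1)) =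
        1 / 2 * ∑ i ∈ Finset.range n, 1 / (C * ((i : ℝ) + 1)) := by
      rw [Finset.mul_sum, Finset.mul_sum]
      refine Finset.sum_congr rfl fun i _ => ?_
      have : (i : ℝ) + 1 ≠ 0 := by positivity
      field_simp
    rw [heq]
    linarith
  have hlim := (Real.tendsto_sum_range_one_div_nat_succ_atTop.const_mul_atTop
    (show 0 < 1 / (2 * C) by positivity))
  have := Filter.tendsto_atTop_mono hlow hlim
  simpa using Filter.tendsto_atTop_add_const_right _ (-1) this

/-- A continued fraction with positive partial numerators of at most linear growth converges to
`G 1` for every positive solution `G` of its recurrence with `G 0 = 1`. -/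
theorem pivotContFract_tendsto {e G : ℕ → ℝ} {x C : ℝ} (he₀ : e 0 = 1)
    (he : ∀ n, 0 < -(e (n + 1) * x)) (hC : 1 ≤ C) (heC : ∀ n : ℕ, -(e (n + 1) * x) ≤ C * (n + 1))
    (hG₀ : G 0 = 1) (hGpos : ∀ n, 0 < G n)
    (hG : ∀ n, G n = G (n + 1) - e (n + 1) * x * G (n + 2)) :
    (∀ n, (pivotContFract e x).dens n ≠ 0) ∧
      Filter.Tendsto (fun n => (pivotContFract e x).convs n) Filter.atTop (nhds (G 1)) := by
  set B := (pivotContFract e x).dens with hBdef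
  have hBs : ∀ n, B (n + 2) = B (n + 1) + -(e (n + 1) * x) * B n := fun n => by
    rw [hBdef, pivotContFract_dens_add_two]
    ring
  have hBpos : ∀ n, 0 < B n := fun n => by
    induction n using Nat.twoStepInduction with
    | zero => simp [hBdef]
    | one => simp [hBdef, pivotContFract_dens_one]
    | more n ih₀ ih₁ =>
      rw [hBs]
      have := mul_pos (he n) ih₀
      linarith
  refine ⟨fun n => (hBpos n).ne', ?_⟩
  have hlim := tendsto_dens_mul_dens_div_prod (pivotContFract_dens_zero e x)
    (pivotContFract_dens_one e x) hBs he hC heC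
  rw [tendsto_iff_dist_tendsto_zero]
  refine squeeze_zero (fun _ => dist_nonneg) (fun n => ?_) hlim.inv_tendsto_atTop
  have hrem := pivotContFract_remainder he₀ hG n
  have hmul := pivotContFract_dens_mul hG n
  rw [hG₀] at hrem hmul
  rw [← hBdef] at hrem hmul
  set P := ∏ i ∈ Finset.range n, -(e (i + 1) * x) with hP
  have hPpos : 0 < P := Finset.prod_pos fun i _ => he i
  have habs : |∏ i ∈ Finset.range n, e (i + 1) * x| = P := by
    rw [Finset.abs_prod]
    exact Finset.prod_congr rfl fun i _ => abs_of_neg (by linarith [he i])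
  have hBG : B (n + 1) * G (n + 1) ≤ 1 := by
    have := mul_pos (mul_pos (he n) (hBpos n)) (hGpos (n + 2))
    linarith
  have hconv : (pivotContFract e x).convs n - G 1 =
      -((∏ i ∈ Finset.range n, e (i + 1) * x) * G (n + 1) / B n) := by
    rw [GenContFract.conv_eq_num_div_den, ← hBdef, ← hrem]
    have := (hBpos n).ne'
    field_simp
    ring
  rw [Real.dist_eq, hconv, abs_neg, abs_div, abs_mul, habs, abs_of_pos (hGpos _),
    abs_of_pos (hBpos n)]
  simp only [Pi.inv_apply, inv_div]
  have h1 := hBpos n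
  have h2 := hBpos (n + 1)
  rw [div_le_div_iff₀ h1 (by positivity)]
  calc P * G (n + 1) * (B n * B (n + 1)) = P * B n * (B (n + 1) * G (n + 1)) := by ring
    _ ≤ P * B n * 1 := by gcongr
    _ = P * B n := mul_one _

end Convergence

/-! ### Pochhammer identities -/

section Pochhammer

theorem ascPochhammer_eval_add (a : ℝ) (m n : ℕ) :
    (ascPochhammer ℝ (m + n)).eval a =
      (ascPochhammer ℝ m).eval a * (ascPochhammer ℝ n).eval (a + m) := by
  rw [← ascPochhammer_mul]
  simp

theorem ascPochhammer_eval_succ_left (a : ℝ) (n : ℕ) :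
    (ascPochhammer ℝ (n + 1)).eval a = a * (ascPochhammer ℝ n).eval (a + 1) := by
  rw [ascPochhammer_succ_left]
  simp

end Pochhammer

/-! ### Hankel determinants and Muir–Rogers coefficients -/

section Hankel

/-- Since (a)_(i+j) = (a)_i (a+i)_j, row i has the factor (a)_i. What remains evaluates monic
polynomials of degree j at the nodes a+i, so it is a Vandermonde determinant. -/
theorem det_ascPochhammer_hankel (a : ℝ) (m : ℕ) :
    (Matrix.of fun i j : Fin (m + 1) => (ascPochhammer ℝ ((i : ℕ) + (j : ℕ))).eval a).det =
      (∏ i ∈ Finset.range (m + 1), (ascPochhammer ℝ i).eval a) * m.superFactorial := by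
  have h := Matrix.det_eval_matrixOfPolynomials_eq_det_vandermonde
    (fun i : Fin (m + 1) => ((i : ℕ) : ℝ) + a) (fun j => ascPochhammer ℝ j)
    (fun j => ascPochhammer_natDegree ℝ _) (fun j => monic_ascPochhammer ℝ _)
  rw [Matrix.det_vandermonde_add, Matrix.det_vandermonde_id_eq_superFactorial] at h
  rw [h, ← Fin.prod_univ_eq_prod_range (fun i => (ascPochhammer ℝ i).eval a), ← Matrix.det_mul_column]
  congr 1
  ext i j
  simp [ascPochhammer_eval_add, add_comm]

theorem det_hankel_smul_pow (c : ℕ → ℝ) (r s : ℝ) (m : ℕ) :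
    (Matrix.of fun i j : Fin (m + 1) => s * (r ^ ((i : ℕ) + (j : ℕ)) * c ((i : ℕ) + (j : ℕ)))).det =
      s ^ (m + 1) * (∏ i ∈ Finset.range (m + 1), r ^ i) ^ 2 *
        (Matrix.of fun i j : Fin (m + 1) => c ((i : ℕ) + (j : ℕ))).det := by
  rw [← Fin.prod_univ_eq_prod_range (fun i => r ^ i), sq, mul_assoc, mul_assoc,
    ← Matrix.det_mul_column, ← Matrix.det_mul_row]
  have : s ^ (m + 1) = s ^ Fintype.card (Fin (m + 1)) := by simp
  rw [this, ← Matrix.det_smul]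
  congr 1
  ext i j
  simp only [pow_add, Matrix.of_apply, Matrix.smul_apply, smul_eq_mul]
  ring

theorem prod_neg_one_pow_sq (m : ℕ) : (∏ i ∈ Finset.range m, (-1 : ℝ) ^ i) ^ 2 = 1 := by
  rw [← Finset.prod_pow]
  exact Finset.prod_eq_one fun i _ => by rw [← pow_mul, mul_comm, pow_mul]; simp

theorem muirRogersDet_even (a : ℝ) (m : ℕ) :
    muirRogersDet (wallisCoeff a) (2 * m) =
      (∏ i ∈ Finset.range (m + 1), (ascPochhammer ℝ i).eval a) * m.superFactorial := by
  have h := det_hankel_smul_pow (fun n => (ascPochhammer ℝ n).eval a) (-1) 1 m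
  rw [prod_neg_one_pow_sq, det_ascPochhammer_hankel] at h
  simp only [one_mul, one_pow] at h
  have hd : 2 * m / 2 = m := by omega
  rw [← h, muirRogersDet, hd]
  simp [wallisCoeff]

/-- From (a)_(n+1) = a (a+1)_n, the shifted coefficients are -a times those with parameter a+1. -/
theorem muirRogersDet_odd (a : ℝ) (m : ℕ) :
    muirRogersDet (wallisCoeff a) (2 * m + 1) =
      (-a) ^ (m + 1) * ((∏ i ∈ Finset.range (m + 1), (ascPochhammer ℝ i).eval (a + 1)) *
        m.superFactorial) := by
  have h := det_hankel_smul_pow (fun n => (ascPochhammer ℝ n).eval (a + 1)) (-1) (-a) m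
  rw [prod_neg_one_pow_sq, det_ascPochhammer_hankel, mul_one] at h
  have hd : (2 * m + 1) / 2 = m := by omega
  have hr : (2 * m + 1) % 2 = 1 := by omega
  rw [← h, muirRogersDet, hd, hr]
  congr 1
  ext i j
  simp only [Matrix.of_apply, wallisCoeff, ascPochhammer_eval_succ_left]
  ring

/-- For n ≥ 3, e_n is the quotient of α_n/α_(n-2) by α_(n-1)/α_(n-3), so only such two-step ratios
are needed. -/
theorem muirRogersDet_even_succ (a : ℝ) (m : ℕ) :
    muirRogersDet (wallisCoeff a) (2 * m + 2) =
      muirRogersDet (wallisCoeff a) (2 * m) *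
        ((ascPochhammer ℝ (m + 1)).eval a * (m + 1).factorial) := by
  rw [show 2 * m + 2 = 2 * (m + 1) by ring, muirRogersDet_even, muirRogersDet_even,
    Finset.prod_range_succ _ (m + 1), Nat.superFactorial_succ]
  push_cast
  ring

theorem muirRogersDet_odd_succ (a : ℝ) (m : ℕ) :
    muirRogersDet (wallisCoeff a) (2 * m + 3) =
      muirRogersDet (wallisCoeff a) (2 * m + 1) *
        (-(ascPochhammer ℝ (m + 2)).eval a * (m + 1).factorial) := by
  rw [show 2 * m + 3 = 2 * (m + 1) + 1 by ring, muirRogersDet_odd, muirRogersDet_odd,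
    Finset.prod_range_succ _ (m + 1), Nat.superFactorial_succ, ascPochhammer_eval_succ_left a]
  push_cast
  ring

theorem muirRogersDet_wallisCoeff_ne_zero {a : ℝ} (ha : 0 < a) (n : ℕ) :
    muirRogersDet (wallisCoeff a) n ≠ 0 := by
  have hsf : ∀ m : ℕ, (m.superFactorial : ℝ) ≠ 0 := fun m => by
    rw [← Nat.prod_range_succ_factorial]
    exact_mod_cast Finset.prod_ne_zero_iff.2 fun i _ => Nat.factorial_ne_zero i
  have hprod : ∀ b : ℝ, 0 < b → ∀ m, ∏ i ∈ Finset.range m, (ascPochhammer ℝ i).eval b ≠ 0 :=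
    fun b hb m => Finset.prod_ne_zero_iff.2 fun i _ => (ascPochhammer_pos i b hb).ne'
  obtain ⟨m, rfl | rfl⟩ := n.even_or_odd'
  · rw [muirRogersDet_even]
    exact mul_ne_zero (hprod a ha _) (hsf m)
  · rw [muirRogersDet_odd]
    exact mul_ne_zero (pow_ne_zero _ (by linarith)) (mul_ne_zero (hprod _ (by linarith) _) (hsf m))

theorem muirRogersCoeff_wallisCoeff_zero (a : ℝ) : muirRogersCoeff (wallisCoeff a) 0 = 1 := by
  have h := muirRogersDet_even a 0
  rw [muirRogersCoeff]
  simpa using h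

theorem muirRogersCoeff_wallisCoeff_even {a : ℝ} (ha : 0 < a) (m : ℕ) :
    muirRogersCoeff (wallisCoeff a) (2 * m + 2) = -((m : ℝ) + 1) := by
  have hne := muirRogersDet_wallisCoeff_ne_zero ha
  cases m with
  | zero =>
    have h0 := muirRogersDet_even a 0
    have h1 := muirRogersDet_odd a 0
    have h2 := muirRogersDet_even_succ a 0
    simp only [mul_zero, zero_add] at h0 h1 h2 ⊢
    rw [muirRogersCoeff, h2, h1, h0]
    simp
    field_simp
  | succ p =>
    rw [show 2 * (p + 1) + 2 = (2 * p + 1) + 3 by ring, muirRogersCoeff,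
      show 2 * p + 1 + 3 = 2 * (p + 1) + 2 by ring, muirRogersDet_even_succ,
      show 2 * p + 1 + 2 = 2 * p + 3 by ring, muirRogersDet_odd_succ,
      show 2 * p + 1 + 1 = 2 * (p + 1) by ring]
    have h1 := hne (2 * p + 1)
    have h2 := hne (2 * (p + 1))
    have h3 := (ascPochhammer_pos (p + 2) a ha).ne'
    have h4 : ((p + 1).factorial : ℝ) ≠ 0 := by exact_mod_cast (p + 1).factorial_ne_zero
    rw [Nat.factorial_succ (p + 1), show p + 1 + 1 = p + 2 by ring]
    field_simp
    push_cast
    ring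

theorem muirRogersCoeff_wallisCoeff_odd {a : ℝ} (ha : 0 < a) (m : ℕ) :
    muirRogersCoeff (wallisCoeff a) (2 * m + 1) = -(a + m) := by
  have hne := muirRogersDet_wallisCoeff_ne_zero ha
  cases m with
  | zero =>
    have h0 := muirRogersDet_even a 0
    have h1 := muirRogersDet_odd a 0
    simp only [mul_zero, zero_add] at h0 h1 ⊢
    rw [muirRogersCoeff, h1, h0]
    simp
  | succ p =>
    rw [show 2 * (p + 1) + 1 = 2 * p + 3 by ring, muirRogersCoeff, muirRogersDet_odd_succ,
      muirRogersDet_even_succ]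
    have h1 := hne (2 * p + 1)
    have h2 := hne (2 * p)
    have h3 := (ascPochhammer_pos (p + 1) a ha).ne'
    have h4 : ((p + 1).factorial : ℝ) ≠ 0 := by exact_mod_cast (p + 1).factorial_ne_zero
    rw [ascPochhammer_succ_eval (p + 1)]
    field_simp

end Hankel

/-! ### The formal series ₂F₀ -/

section HypergeometricSeries

/-- The formal hypergeometric series `₂F₀(p, q; -X)`. -/
noncomputable def formalTwoFZero (p q : ℝ) : PowerSeries ℝ :=
  PowerSeries.mk fun n =>
    (-1) ^ n * (ascPochhammer ℝ n).eval p * (ascPochhammer ℝ n).eval q / (n.factorial : ℝ)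

theorem formalTwoFZero_comm (p q : ℝ) : formalTwoFZero p q = formalTwoFZero q p := by
  ext n
  simp only [formalTwoFZero, PowerSeries.coeff_mk]
  ring

theorem formalTwoFZero_zero (p : ℝ) : formalTwoFZero p 0 = 1 := by
  ext n
  rw [formalTwoFZero, PowerSeries.coeff_mk, PowerSeries.coeff_one, ascPochhammer_eval_zero]
  split_ifs with h
  · simp [h]
  · simp

theorem formalTwoFZero_one (p : ℝ) : formalTwoFZero p 1 = PowerSeries.mk (wallisCoeff p) := by
  ext n
  rw [formalTwoFZero, PowerSeries.coeff_mk, PowerSeries.coeff_mk, wallisCoeff,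
    ascPochhammer_eval_one]
  have : (n.factorial : ℝ) ≠ 0 := by exact_mod_cast n.factorial_ne_zero
  field_simp

/-- Coefficientwise this is the identity q + n + 1 - (n + 1) = q. The symmetry of ₂F₀ supplies the
relation that raises `p`. -/
theorem formalTwoFZero_contiguous (p q : ℝ) :
    formalTwoFZero p q = formalTwoFZero p (q + 1) +
      PowerSeries.C p * PowerSeries.X * formalTwoFZero (p + 1) (q + 1) := by
  ext n
  rw [mul_assoc, map_add, PowerSeries.coeff_C_mul]
  cases n with
  | zero => simp [formalTwoFZero]
  | succ n =>
    rw [PowerSeries.coeff_succ_X_mul]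
    simp only [formalTwoFZero, PowerSeries.coeff_mk]
    rw [ascPochhammer_eval_succ_left p, ascPochhammer_eval_succ_left q,
      ascPochhammer_succ_eval n (q + 1), Nat.factorial_succ]
    have : (n.factorial : ℝ) ≠ 0 := by exact_mod_cast n.factorial_ne_zero
    have : (n : ℝ) + 1 ≠ 0 := by positivity
    push_cast
    field_simp
    ring

end HypergeometricSeries

/-! ### From contiguous relations to the recurrence -/

section Staircase

/-- The sequence `f (a + m) m, f (a + m) (m + 1)`, `m = 0, 1, …`, solves a three-term recurrence
if `f` satisfies both contiguous relations of `₂F₀`. -/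
theorem staircase_recurrence {R : Type*} [CommRing R] {a : ℝ} (ha : 0 < a) (φ : ℝ → R)
    (hφ : ∀ r, φ (-r) = -φ r) (x : R) (f : ℝ → ℕ → R)
    (h₁ : ∀ p q, 0 < p → f p q = f p (q + 1) + φ p * x * f (p + 1) (q + 1))
    (h₂ : ∀ p q, 0 < p → f p q = f (p + 1) q + φ q * x * f (p + 1) (q + 1)) (n : ℕ) :
    f (a + (n / 2 : ℕ)) ((n + 1) / 2) = f (a + ((n + 1) / 2 : ℕ)) ((n + 1 + 1) / 2) -
      φ (muirRogersCoeff (wallisCoeff a) (n + 1)) * x *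
        f (a + ((n + 2) / 2 : ℕ)) ((n + 2 + 1) / 2) := by
  obtain ⟨m, rfl | rfl⟩ := n.even_or_odd'
  · rw [muirRogersCoeff_wallisCoeff_odd ha, hφ, show 2 * m / 2 = m by omega,
      show (2 * m + 1) / 2 = m by omega, show (2 * m + 1 + 1) / 2 = m + 1 by omega,
      show (2 * m + 2 + 1) / 2 = m + 1 by omega,
      h₁ (a + m) m (by positivity)]
    push_cast
    rw [add_assoc a]
    ring
  · rw [muirRogersCoeff_wallisCoeff_even ha, hφ, show (2 * m + 1) / 2 = m by omega,
      show (2 * m + 1 + 1) / 2 = m + 1 by omega, show (2 * m + 1 + 1 + 1) / 2 = m + 1 by omega,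
      show (2 * m + 1 + 2 + 1) / 2 = m + 2 by omega,
      h₂ (a + m) (m + 1) (by positivity)]
    push_cast
    rw [add_assoc a]
    ring

end Staircase

open MeasureTheory Set Filter Topology

/-! ### Gamma weights -/

section GammaWeight

/-- The weight `s^(p-1) e^(-s)` of the Gamma integral. -/
noncomputable def gammaWeight (p s : ℝ) : ℝ := s ^ (p - 1) * Real.exp (-s)

theorem gammaWeight_pos {p s : ℝ} (hs : 0 < s) : 0 < gammaWeight p s :=
  mul_pos (Real.rpow_pos_of_pos hs _) (Real.exp_pos _)

theorem gammaWeight_integrableOn {p : ℝ} (hp : 0 < p) :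
    IntegrableOn (gammaWeight p) (Ioi 0) := by
  simpa only [gammaWeight, mul_comm] using! Real.GammaIntegral_convergent hp

theorem integral_gammaWeight {p : ℝ} (hp : 0 < p) :
    ∫ s in Ioi 0, gammaWeight p s = Real.Gamma p := by
  simp only [Real.Gamma_eq_integral hp, gammaWeight, mul_comm]

theorem gammaWeight_mul_pow {p s : ℝ} (hs : 0 < s) (n : ℕ) :
    gammaWeight p s * s ^ n = gammaWeight (p + n) s := by
  rw [gammaWeight, gammaWeight, show p + n - 1 = p - 1 + n by ring, Real.rpow_add_natCast hs.ne']
  ring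

theorem Gamma_add_natCast {p : ℝ} (hp : 0 < p) (n : ℕ) :
    Real.Gamma (p + n) = (ascPochhammer ℝ n).eval p * Real.Gamma p := by
  induction n with
  | zero => simp
  | succ n ih =>
    rw [Nat.cast_succ, ← add_assoc, Real.Gamma_add_one (by positivity), ih,
      ascPochhammer_succ_eval]
    ring

theorem gammaWeight_mul_integrableOn {p : ℝ} (hp : 0 < p) {f : ℝ → ℝ} {C : ℝ}
    (hf : ContinuousOn f (Ioi 0)) (hC : ∀ s, 0 < s → |f s| ≤ C) :
    IntegrableOn (fun s => gammaWeight p s * f s) (Ioi 0) := by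
  refine Integrable.mul_bdd (c := C) (gammaWeight_integrableOn hp)
    (hf.aestronglyMeasurable measurableSet_Ioi) ?_
  exact (ae_restrict_iff' measurableSet_Ioi).2 (Eventually.of_forall hC)

end GammaWeight

/-! ### The integral analogue of ₂F₀ -/

section StieltjesIntegral

/-- The function `Γ(p)⁻¹ ∫₀^∞ s^(p-1) e^(-s) (1 + x s)^(-q) ds`, whose asymptotic series
at `0` is `₂F₀(p, q; -x)`. -/
noncomputable def twoFZeroIntegral (x p : ℝ) (q : ℕ) : ℝ :=
  (Real.Gamma p)⁻¹ * ∫ s in Ioi 0, gammaWeight p s * ((1 + x * s) ^ q)⁻¹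

variable {x p : ℝ}

theorem continuousOn_inv_one_add_mul_pow (hx : 0 < x) (q : ℕ) :
    ContinuousOn (fun s : ℝ => ((1 + x * s) ^ q)⁻¹) (Ici 0) := by
  refine ContinuousOn.inv₀ (by fun_prop) fun s hs => ?_
  have : 0 ≤ x * s := mul_nonneg hx.le hs
  positivity

theorem abs_inv_one_add_mul_pow_le (hx : 0 < x) (q : ℕ) {s : ℝ} (hs : 0 ≤ s) :
    |((1 + x * s) ^ q)⁻¹| ≤ 1 := by
  have : 0 ≤ x * s := mul_nonneg hx.le hs
  rw [abs_of_nonneg (by positivity)]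
  exact inv_le_one_of_one_le₀ (one_le_pow₀ (by linarith))

theorem twoFZeroIntegrand_integrableOn (hx : 0 < x) (hp : 0 < p) (q : ℕ) :
    IntegrableOn (fun s => gammaWeight p s * ((1 + x * s) ^ q)⁻¹) (Ioi 0) :=
  gammaWeight_mul_integrableOn hp
    ((continuousOn_inv_one_add_mul_pow hx q).mono Ioi_subset_Ici_self)
    fun _ hs => abs_inv_one_add_mul_pow_le hx q hs.le

theorem twoFZeroIntegral_zero (hp : 0 < p) : twoFZeroIntegral x p 0 = 1 := by
  simp only [twoFZeroIntegral, pow_zero, inv_one, mul_one, integral_gammaWeight hp]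
  exact inv_mul_cancel₀ (Real.Gamma_pos_of_pos hp).ne'

theorem twoFZeroIntegral_one (x p : ℝ) : twoFZeroIntegral x p 1 = wallisIntegral p x := by
  simp only [twoFZeroIntegral, wallisIntegral, wallisIntegrand, gammaWeight, pow_one, div_eq_mul_inv,
    one_mul]

theorem twoFZeroIntegral_pos (hx : 0 < x) (hp : 0 < p) (q : ℕ) : 0 < twoFZeroIntegral x p q := by
  refine mul_pos (inv_pos.2 (Real.Gamma_pos_of_pos hp)) ?_
  have hpos : ∀ s ∈ Ioi (0 : ℝ), 0 < gammaWeight p s * ((1 + x * s) ^ q)⁻¹ := fun s hs => by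
    have h1 : 0 < x * s := mul_pos hx hs
    have h2 := gammaWeight_pos (p := p) hs
    positivity
  rw [setIntegral_pos_iff_support_of_nonneg_ae
    ((ae_restrict_iff' measurableSet_Ioi).2 (Eventually.of_forall fun s hs => (hpos s hs).le))
    (twoFZeroIntegrand_integrableOn hx hp q)]
  have hsub : Ioi (0 : ℝ) ⊆
      Function.support (fun s => gammaWeight p s * ((1 + x * s) ^ q)⁻¹) ∩ Ioi 0 :=
    fun s hs => ⟨(hpos s hs).ne', hs⟩
  exact lt_of_lt_of_le (by simp) (measure_mono hsub)

/-- Multiply and divide the integrand by 1 + xs; the factor s raises `p`, and Γ(p+1) = pΓ(p)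
produces the coefficient. -/
theorem twoFZeroIntegral_contiguous_right (hx : 0 < x) (hp : 0 < p) (q : ℕ) :
    twoFZeroIntegral x p q =
      twoFZeroIntegral x p (q + 1) + p * x * twoFZeroIntegral x (p + 1) (q + 1) := by
  have hΓ := (Real.Gamma_pos_of_pos hp).ne'
  have hi : ∫ s in Ioi 0, gammaWeight p s * ((1 + x * s) ^ q)⁻¹ =
      (∫ s in Ioi 0, gammaWeight p s * ((1 + x * s) ^ (q + 1))⁻¹) +
        x * ∫ s in Ioi 0, gammaWeight (p + 1) s * ((1 + x * s) ^ (q + 1))⁻¹ := by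
    rw [← integral_const_mul, ← integral_add (twoFZeroIntegrand_integrableOn hx hp _)
      ((twoFZeroIntegrand_integrableOn hx (by positivity) _).const_mul x)]
    refine setIntegral_congr_fun measurableSet_Ioi fun s hs => ?_
    have hs' : 0 < s := hs
    have h1 : 1 + x * s ≠ 0 := by positivity
    have h2 := gammaWeight_mul_pow (p := p) hs' 1
    rw [Nat.cast_one, pow_one] at h2
    simp only [← h2]
    field_simp
    ring
  rw [twoFZeroIntegral, twoFZeroIntegral, twoFZeroIntegral, hi, Real.Gamma_add_one hp.ne']
  have := hp.ne'
  field_simp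

/-- Integration by parts: s^p e^(-s) (1+xs)^(-q) vanishes at 0 and at infinity, so its derivative
has integral 0. -/
theorem twoFZeroIntegral_contiguous_left (hx : 0 < x) (hp : 0 < p) (q : ℕ) :
    twoFZeroIntegral x p q =
      twoFZeroIntegral x (p + 1) q + q * x * twoFZeroIntegral x (p + 1) (q + 1) := by
  have hΓ := (Real.Gamma_pos_of_pos hp).ne'
  have hI₀ := twoFZeroIntegrand_integrableOn hx hp q
  have hI₁ := twoFZeroIntegrand_integrableOn hx (show 0 < p + 1 by positivity) q
  have hI₂ := twoFZeroIntegrand_integrableOn hx (show 0 < p + 1 by positivity) (q + 1)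
  have hparts : ∫ s in Ioi 0, (p * (gammaWeight p s * ((1 + x * s) ^ q)⁻¹) -
      gammaWeight (p + 1) s * ((1 + x * s) ^ q)⁻¹ -
      q * x * (gammaWeight (p + 1) s * ((1 + x * s) ^ (q + 1))⁻¹)) = 0 := by
    have h := integral_Ioi_of_hasDerivAt_of_tendsto (a := 0) (m := 0)
      (f := fun s => gammaWeight (p + 1) s * ((1 + x * s) ^ q)⁻¹)
      (f' := fun s => p * (gammaWeight p s * ((1 + x * s) ^ q)⁻¹) -
        gammaWeight (p + 1) s * ((1 + x * s) ^ q)⁻¹ -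
        q * x * (gammaWeight (p + 1) s * ((1 + x * s) ^ (q + 1))⁻¹)) ?_ ?_ ?_ ?_
    · rw [h]
      simp [gammaWeight, hp.ne']
    · refine ContinuousWithinAt.mul (Continuous.continuousWithinAt ?_)
        (continuousOn_inv_one_add_mul_pow hx q 0 self_mem_Ici)
      unfold gammaWeight
      exact (Real.continuous_rpow_const (by linarith)).mul (by fun_prop)
    · intro s hs
      have hs' : 0 < s := hs
      have h1 : 1 + x * s ≠ 0 := by positivity
      have hr := Real.hasDerivAt_rpow_const (x := s) (p := p) (Or.inl hs'.ne')
      have he := (hasDerivAt_neg s).exp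
      have hl := ((((hasDerivAt_id s).const_mul x).const_add 1).pow q).inv (pow_ne_zero q h1)
      have h := (hr.mul he).mul hl
      have hfun : (fun s => gammaWeight (p + 1) s * ((1 + x * s) ^ q)⁻¹) =
          ((fun y => y ^ p) * fun y => Real.exp (-y)) * ((fun s => 1 + x * s) ^ q)⁻¹ := by
        ext y
        simp [gammaWeight]
      rw [hfun]
      refine h.congr_deriv ?_
      have h3 : s ^ p = s ^ (p - 1) * s := by
        rw [← Real.rpow_add_one hs'.ne', sub_add_cancel]
      simp only [gammaWeight, add_sub_cancel_right, h3, Pi.mul_apply, Pi.pow_apply, Pi.inv_apply, id]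
      -- The derivative of the power has the truncated exponent `q - 1`, hence the separate case `q
      -- = 0`.
      cases q with
      | zero => simp; ring
      | succ r =>
        simp only [Nat.add_sub_cancel]
        field_simp
        ring
    · exact ((hI₀.const_mul p).sub hI₁).sub (hI₂.const_mul _)
    · have hlim : Tendsto (fun s : ℝ => s ^ p * Real.exp (-s)) atTop (𝓝 0) := by
        simpa using tendsto_rpow_mul_exp_neg_mul_atTop_nhds_zero p 1 one_pos
      refine squeeze_zero_norm' ?_ hlim
      filter_upwards [eventually_gt_atTop 0] with s hs
      rw [norm_mul, Real.norm_of_nonneg (gammaWeight_pos hs).le, gammaWeight, add_sub_cancel_right]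
      exact mul_le_of_le_one_right (by positivity) (abs_inv_one_add_mul_pow_le hx q hs.le)
  rw [integral_sub (by exact (hI₀.const_mul p).sub hI₁) (hI₂.const_mul _),
    integral_sub (hI₀.const_mul p) hI₁, integral_const_mul, integral_const_mul] at hparts
  rw [twoFZeroIntegral, twoFZeroIntegral, twoFZeroIntegral, Real.Gamma_add_one hp.ne']
  generalize ∫ s in Ioi 0, gammaWeight p s * ((1 + x * s) ^ q)⁻¹ = I₀ at *
  generalize ∫ s in Ioi 0, gammaWeight (p + 1) s * ((1 + x * s) ^ q)⁻¹ = I₁ at *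
  generalize ∫ s in Ioi 0, gammaWeight (p + 1) s * ((1 + x * s) ^ (q + 1))⁻¹ = I₂ at *
  have := hp.ne'
  field_simp
  linarith

end StieltjesIntegral

/-! ### Divergence and asymptotic expansion -/

section AsymptoticSeries

variable {a x : ℝ}

theorem wallisIntegrand_integrableOn (ha : 0 < a) (hx : 0 < x) :
    IntegrableOn (wallisIntegrand a x) (Ioi 0) := by
  simpa only [pow_one, gammaWeight, ← div_eq_mul_inv] using!
    twoFZeroIntegrand_integrableOn hx ha 1

theorem wallisSeries_diverges (ha : 0 < a) (hx : x ≠ 0) :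
    ¬ ∃ l : ℝ, Tendsto (fun N : ℕ => ∑ n ∈ Finset.range N, wallisCoeff a n * x ^ n)
      atTop (𝓝 l) := by
  rintro ⟨l, hl⟩
  have hterm : Tendsto (fun n => |wallisCoeff a n * x ^ n|) atTop (𝓝 0) := by
    have h := ((hl.comp (tendsto_add_atTop_nat 1)).sub hl).abs
    simpa [Finset.sum_range_succ, Function.comp_def] using h
  have hx' : 0 < |x| := abs_pos.2 hx
  have habs : ∀ n, |wallisCoeff a n * x ^ n| = (ascPochhammer ℝ n).eval a * |x| ^ n := fun n => by
    rw [wallisCoeff, abs_mul, abs_mul, abs_pow, abs_pow, abs_neg, abs_one, one_pow, one_mul,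
      abs_of_pos (ascPochhammer_pos n a ha)]
  -- From `M` on, the ratio (a+n)|x| of consecutive terms is at least 1, so the terms cannot tend to
  -- 0.
  obtain ⟨M, hM⟩ := exists_nat_ge |x|⁻¹
  have hmono : ∀ n, M ≤ n → |wallisCoeff a M * x ^ M| ≤ |wallisCoeff a n * x ^ n| := by
    intro n hn
    induction n, hn using Nat.le_induction with
    | base => exact le_rfl
    | succ n hn ih =>
      refine ih.trans ?_
      rw [habs, habs, ascPochhammer_succ_eval, pow_succ]
      have h1 : 1 ≤ (a + n) * |x| := by
        rw [← inv_le_iff_one_le_mul₀ hx']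
        have : (M : ℝ) ≤ n := by exact_mod_cast hn
        linarith
      have h2 := (ascPochhammer_pos n a ha).le
      calc _ ≤ (ascPochhammer ℝ n).eval a * |x| ^ n * ((a + n) * |x|) :=
            le_mul_of_one_le_right (by positivity) h1
        _ = _ := by ring
  have hle := ge_of_tendsto hterm (eventually_atTop.2 ⟨M, hmono⟩)
  have := ascPochhammer_pos M a ha
  rw [habs] at hle
  have : 0 < (ascPochhammer ℝ M).eval a * |x| ^ M := by positivity
  linarith

theorem gammaWeight_mul_pow_integrableOn (ha : 0 < a) (n : ℕ) :
    IntegrableOn (fun s => gammaWeight a s * s ^ n) (Ioi 0) :=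
  (integrableOn_congr_fun (fun _ hs => gammaWeight_mul_pow hs n) measurableSet_Ioi).2
    (gammaWeight_integrableOn (by positivity))

theorem integral_gammaWeight_mul_pow (ha : 0 < a) (n : ℕ) :
    ∫ s in Ioi 0, gammaWeight a s * s ^ n = (ascPochhammer ℝ n).eval a * Real.Gamma a := by
  rw [setIntegral_congr_fun measurableSet_Ioi (fun _ hs => gammaWeight_mul_pow hs n),
    integral_gammaWeight (by positivity), Gamma_add_natCast ha]

theorem wallisIntegral_sub_sum (ha : 0 < a) (hx : 0 < x) (N : ℕ) :
    wallisIntegral a x - ∑ n ∈ Finset.range N, wallisCoeff a n * x ^ n =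
      (Real.Gamma a)⁻¹ * ∫ s in Ioi 0, (-x) ^ N * (gammaWeight (a + N) s * ((1 + x * s) ^ 1)⁻¹) := by
  have hΓ := (Real.Gamma_pos_of_pos ha).ne'
  induction N with
  | zero =>
    rw [← twoFZeroIntegral_one]
    simp [twoFZeroIntegral]
  | succ N ih =>
    have haN : 0 < a + N := by positivity
    have haN' : 0 < a + (N + 1 : ℕ) := by positivity
    -- One step of the geometric expansion, 1/(1+xs) = 1 - xs/(1+xs).
    have hsplit : ∫ s in Ioi 0, (-x) ^ N * (gammaWeight (a + N) s * ((1 + x * s) ^ 1)⁻¹) =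
        (∫ s in Ioi 0, (-x) ^ N * (gammaWeight a s * s ^ N)) +
        ∫ s in Ioi 0, (-x) ^ (N + 1) *
          (gammaWeight (a + (N + 1 : ℕ)) s * ((1 + x * s) ^ 1)⁻¹) := by
      rw [← integral_add ((gammaWeight_mul_pow_integrableOn ha N).const_mul _)
        ((twoFZeroIntegrand_integrableOn hx haN' 1).const_mul _)]
      refine setIntegral_congr_fun measurableSet_Ioi fun s hs => ?_
      have hs' : 0 < s := hs
      have h1 : 1 + x * s ≠ 0 := by positivity
      simp only [← gammaWeight_mul_pow hs']
      field_simp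
      ring
    rw [Finset.sum_range_succ, ← sub_sub, ih, hsplit, integral_const_mul,
      integral_gammaWeight_mul_pow ha, wallisCoeff, neg_pow x N]
    field_simp
    ring

theorem wallisIntegral_sub_sum_isBigO (ha : 0 < a) (N : ℕ) :
    (fun x : ℝ => wallisIntegral a x - ∑ n ∈ Finset.range N, wallisCoeff a n * x ^ n)
      =O[𝓝[>] 0] (fun x : ℝ => x ^ N) := by
  refine Asymptotics.IsBigO.of_bound ((Real.Gamma a)⁻¹ * Real.Gamma (a + N)) ?_
  filter_upwards [self_mem_nhdsWithin] with x hx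
  have hx' : 0 < x := hx
  have haN : 0 < a + N := by positivity
  rw [wallisIntegral_sub_sum ha hx', integral_const_mul, norm_mul, norm_mul, norm_pow, norm_neg,
    norm_pow, Real.norm_of_nonneg (inv_pos.2 (Real.Gamma_pos_of_pos ha)).le]
  have hle : ‖∫ s in Ioi 0, gammaWeight (a + N) s * ((1 + x * s) ^ 1)⁻¹‖ ≤ Real.Gamma (a + N) := by
    rw [← integral_gammaWeight haN]
    refine norm_integral_le_of_norm_le (gammaWeight_integrableOn haN)
      ((ae_restrict_iff' measurableSet_Ioi).2 (Eventually.of_forall fun s hs => ?_))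
    have hs' : 0 < s := hs
    rw [norm_mul, Real.norm_of_nonneg (gammaWeight_pos hs').le]
    exact mul_le_of_le_one_right (gammaWeight_pos hs').le (abs_inv_one_add_mul_pow_le hx' 1 hs'.le)
  have := Real.Gamma_pos_of_pos ha
  calc _ ≤ (Real.Gamma a)⁻¹ * (‖x‖ ^ N * Real.Gamma (a + N)) := by gcongr
    _ = _ := by ring

end AsymptoticSeries

/-! ### Termwise integration of the double integral -/

section DoubleIntegral

variable {a x : ℝ}

theorem integral_exp_neg_mul_pow (n : ℕ) :
    ∫ t in Ioi (0 : ℝ), Real.exp (-t) * t ^ n = n.factorial := by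
  rw [← Real.Gamma_nat_eq_factorial, Real.Gamma_eq_integral (by positivity)]
  simp

theorem exp_neg_mul_pow_integrableOn (n : ℕ) :
    IntegrableOn (fun t : ℝ => Real.exp (-t) * t ^ n) (Ioi 0) := by
  have h := Real.GammaIntegral_convergent (s := (n : ℝ) + 1) (by positivity)
  simpa using h

/-- Separating the variables reduces integrability and the value to two Gamma integrals. -/
theorem wallisTerm_eq (a x : ℝ) (n : ℕ) (s t : ℝ) :
    wallisTerm a x n s t = (-x) ^ n / n.factorial *
      (gammaWeight a s * s ^ n) * (Real.exp (-t) * t ^ n) := by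
  rw [wallisTerm, gammaWeight, show -(t * x * s) = -x * s * t by ring, mul_pow, mul_pow]
  ring

theorem wallisTerm_integrableOn (ha : 0 < a) (n : ℕ) :
    IntegrableOn (fun p : ℝ × ℝ => wallisTerm a x n p.1 p.2) (Ioi 0 ×ˢ Ioi 0) := by
  simp only [wallisTerm_eq]
  rw [IntegrableOn, Measure.volume_eq_prod, ← Measure.prod_restrict]
  exact ((gammaWeight_mul_pow_integrableOn ha n).const_mul _).mul_prod
    (exp_neg_mul_pow_integrableOn n)

theorem integral_wallisTerm (ha : 0 < a) (n : ℕ) :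
    1 / Real.Gamma a * ∫ s in Ioi (0 : ℝ), ∫ t in Ioi (0 : ℝ), wallisTerm a x n s t =
      wallisCoeff a n * x ^ n := by
  have hΓ := (Real.Gamma_pos_of_pos ha).ne'
  have hn : (n.factorial : ℝ) ≠ 0 := by exact_mod_cast n.factorial_ne_zero
  simp only [wallisTerm_eq, integral_const_mul, integral_exp_neg_mul_pow, integral_mul_const,
    integral_gammaWeight_mul_pow ha, wallisCoeff, neg_pow x n]
  field_simp

theorem hasSum_wallisTerm (a x s t : ℝ) :
    HasSum (fun n : ℕ => wallisTerm a x n s t)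
      (s ^ (a - 1) * Real.exp (-s) * Real.exp (-(t * (1 + x * s)))) := by
  have h : HasSum (fun n : ℕ => (-(t * x * s)) ^ n / (n.factorial : ℝ))
      (Real.exp (-(t * x * s))) := by
    rw [Real.exp_eq_exp_ℝ]
    exact NormedSpace.expSeries_div_hasSum_exp _
  rw [show -(t * (1 + x * s)) = -t + -(t * x * s) by ring, Real.exp_add]
  exact (h.mul_left _).mul_left _

theorem doubleIntegrand_integrableOn (ha : 0 < a) (hx : 0 < x) :
    IntegrableOn (fun p : ℝ × ℝ =>
        p.1 ^ (a - 1) * Real.exp (-p.1) * Real.exp (-(p.2 * (1 + x * p.1))))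
      (Ioi 0 ×ˢ Ioi 0) := by
  have hdom : IntegrableOn (fun p : ℝ × ℝ => gammaWeight a p.1 * (Real.exp (-p.2) * p.2 ^ 0))
      (Ioi 0 ×ˢ Ioi 0) := by
    rw [IntegrableOn, Measure.volume_eq_prod, ← Measure.prod_restrict]
    exact (gammaWeight_integrableOn ha).mul_prod (exp_neg_mul_pow_integrableOn 0)
  refine Integrable.mono' hdom (Measurable.aestronglyMeasurable (by fun_prop))
    ((ae_restrict_iff' (measurableSet_Ioi.prod measurableSet_Ioi)).2 (Eventually.of_forall ?_))
  rintro ⟨s, t⟩ ⟨hs, ht⟩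
  have hs' : 0 < s := hs
  have ht' : 0 < t := ht
  have h := (gammaWeight_pos (p := a) hs').le
  change ‖gammaWeight a s * _‖ ≤ _
  rw [norm_mul, Real.norm_of_nonneg h, Real.norm_of_nonneg (Real.exp_pos _).le, pow_zero, mul_one]
  refine mul_le_mul_of_nonneg_left (Real.exp_le_exp.2 ?_) h
  have : 0 < t * (x * s) := by positivity
  change -(t * (1 + x * s)) ≤ -t
  linarith

theorem wallisIntegral_eq_doubleIntegral (a : ℝ) (hx : 0 < x) :
    wallisIntegral a x = 1 / Real.Gamma a * ∫ s in Ioi (0 : ℝ), ∫ t in Ioi (0 : ℝ),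
      s ^ (a - 1) * Real.exp (-s) * Real.exp (-(t * (1 + x * s))) := by
  rw [wallisIntegral]
  congr 1
  refine setIntegral_congr_fun measurableSet_Ioi fun s hs => ?_
  have hs' : 0 < s := hs
  have h1 : 0 < 1 + x * s := by positivity
  have h := Real.integral_rpow_mul_exp_neg_mul_Ioi one_pos h1
  simp only [sub_self, Real.rpow_zero, one_mul, Real.rpow_one, Real.Gamma_one, mul_one,
    mul_comm (1 + x * s)] at h
  simp only [integral_const_mul, h, wallisIntegrand]
  ring

end DoubleIntegral

/-! ### Application to the Wallis series -/

section Wallis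

variable {a x : ℝ}

theorem formalPivotContFract_wallisCoeff (ha : 0 < a) (n : ℕ) :
    (formalPivotContFract (muirRogersCoeff (wallisCoeff a))).dens n ≠ 0 ∧
      ∀ k : ℤ, k < n →
        ((formalPivotContFract (muirRogersCoeff (wallisCoeff a))).convs n).coeff k =
          (HahnSeries.ofPowerSeries ℤ ℝ (PowerSeries.mk (wallisCoeff a))).coeff k := by
  have hrec := staircase_recurrence ha (fun r => PowerSeries.C r) (fun r => map_neg _ r)
    PowerSeries.X (fun p q => formalTwoFZero p q)
    (fun p q _ => by
      rw [formalTwoFZero_contiguous p q]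
      push_cast
      rfl)
    (fun p q _ => by
      rw [formalTwoFZero_comm p, formalTwoFZero_contiguous q p, formalTwoFZero_comm q,
        formalTwoFZero_comm (q + 1 : ℝ)]
      push_cast
      rfl)
  have h := formalPivotContFract_corresponds (muirRogersCoeff_wallisCoeff_zero a)
    (g := fun n => formalTwoFZero (a + (n / 2 : ℕ)) ((n + 1) / 2 : ℕ))
    (by simp [formalTwoFZero_zero]) hrec n
  simpa [formalTwoFZero_one] using h

theorem pivotContFract_wallisCoeff (ha : 0 < a) (hx : 0 < x) :
    (∀ n : ℕ, (pivotContFract (muirRogersCoeff (wallisCoeff a)) x).dens n ≠ 0) ∧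
      Filter.Tendsto (fun n : ℕ => (pivotContFract (muirRogersCoeff (wallisCoeff a)) x).convs n)
        Filter.atTop (nhds (wallisIntegral a x)) := by
  have hrec := staircase_recurrence ha (fun r => r) (fun r => rfl) x (twoFZeroIntegral x)
    (fun p q hp => twoFZeroIntegral_contiguous_right hx hp q)
    (fun p q hp => twoFZeroIntegral_contiguous_left hx hp q)
  have hcoeff : ∀ n : ℕ, 0 < -muirRogersCoeff (wallisCoeff a) (n + 1) ∧
      -muirRogersCoeff (wallisCoeff a) (n + 1) ≤ (a + 1) * (n + 1) := fun n => by
    obtain ⟨m, rfl | rfl⟩ := n.even_or_odd'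
    · rw [muirRogersCoeff_wallisCoeff_odd ha]
      push_cast
      have : 0 ≤ a * m := by positivity
      constructor <;> nlinarith [Nat.cast_nonneg (α := ℝ) m]
    · rw [muirRogersCoeff_wallisCoeff_even ha]
      push_cast
      have : 0 ≤ a * m := by positivity
      constructor <;> nlinarith [Nat.cast_nonneg (α := ℝ) m]
  -- Linear growth alone needs only C = (a+1)x; the added 1 secures `1 ≤ C`.
  have h := pivotContFract_tendsto (x := x) (C := (a + 1) * x + 1)
    (muirRogersCoeff_wallisCoeff_zero a)
    (fun n => by
      rw [← neg_mul]
      exact mul_pos (hcoeff n).1 hx)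
    (by nlinarith)
    (fun n => by
      have h1 := mul_le_mul_of_nonneg_right (hcoeff n).2 hx.le
      have h2 : (0 : ℝ) ≤ n := n.cast_nonneg
      linarith)
    (G := fun n => twoFZeroIntegral x (a + (n / 2 : ℕ)) ((n + 1) / 2))
    (by simpa using twoFZeroIntegral_zero ha)
    (fun n => twoFZeroIntegral_pos hx (by positivity) _) hrec
  simpa [twoFZeroIntegral_one] using h

end Wallis

theorem mainTheorem2 (a : ℝ) (ha : 0 < a) :
    -- the integral converges for every `x > 0`
    (∀ x : ℝ, 0 < x → MeasureTheory.IntegrableOn (wallisIntegrand a x) (Set.Ioi 0)) ∧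
    -- the series has zero radius of convergence: it diverges for every `x ≠ 0`
    (∀ x : ℝ, x ≠ 0 → ¬ ∃ l : ℝ, Filter.Tendsto
      (fun N : ℕ => ∑ n ∈ Finset.range N, wallisCoeff a n * x ^ n) Filter.atTop (nhds l)) ∧
    -- the series is the asymptotic expansion of the integral as `x → 0+`
    (∀ N : ℕ, (fun x : ℝ => wallisIntegral a x - ∑ n ∈ Finset.range N, wallisCoeff a n * x ^ n)
      =O[nhdsWithin 0 (Set.Ioi 0)] (fun x : ℝ => x ^ N)) ∧
    -- the series arises from a double integral by interchanging summation and integration: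
    -- the integrand is expanded in powers of `x` and integrated term by term
    (∀ x : ℝ, 0 < x →
      MeasureTheory.IntegrableOn
        (fun p : ℝ × ℝ => p.1 ^ (a - 1) * Real.exp (-p.1) * Real.exp (-(p.2 * (1 + x * p.1))))
        (Set.Ioi 0 ×ˢ Set.Ioi 0) ∧
      wallisIntegral a x = 1 / Real.Gamma a * ∫ s in Set.Ioi (0 : ℝ),
        ∫ t in Set.Ioi (0 : ℝ),
          s ^ (a - 1) * Real.exp (-s) * Real.exp (-(t * (1 + x * s))) ∧
      (∀ s t : ℝ, 0 < s → 0 < t → HasSum (fun n : ℕ => wallisTerm a x n s t)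
        (s ^ (a - 1) * Real.exp (-s) * Real.exp (-(t * (1 + x * s))))) ∧
      ∀ n : ℕ,
        MeasureTheory.IntegrableOn (fun p : ℝ × ℝ => wallisTerm a x n p.1 p.2)
          (Set.Ioi 0 ×ˢ Set.Ioi 0) ∧
        1 / Real.Gamma a * ∫ s in Set.Ioi (0 : ℝ), ∫ t in Set.Ioi (0 : ℝ),
          wallisTerm a x n s t = wallisCoeff a n * x ^ n) ∧
    -- the Muir-Rogers formula applies to the series, and its coefficients are the stated ones
    (∀ n : ℕ, muirRogersDet (wallisCoeff a) n ≠ 0) ∧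
    muirRogersCoeff (wallisCoeff a) 0 = 1 ∧
    (∀ m : ℕ, 1 ≤ m → muirRogersCoeff (wallisCoeff a) (2 * m) = -(m : ℝ)) ∧
    (∀ m : ℕ, muirRogersCoeff (wallisCoeff a) (2 * m + 1) = -(a + m)) ∧
    -- the continued fraction corresponds formally to the series: its `n`-th convergent, as a
    -- Laurent series in the pivot variable, has the same coefficients in all degrees below `n`
    (∀ n : ℕ,
      (formalPivotContFract (muirRogersCoeff (wallisCoeff a))).dens n ≠ 0 ∧
      ∀ k : ℤ, k < n →
        ((formalPivotContFract (muirRogersCoeff (wallisCoeff a))).convs n).coeff k =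
          (HahnSeries.ofPowerSeries ℤ ℝ (PowerSeries.mk (wallisCoeff a))).coeff k) ∧
    -- the continued fraction converges to the integral for every `x > 0`
    (∀ x : ℝ, 0 < x →
      (∀ n : ℕ, (pivotContFract (muirRogersCoeff (wallisCoeff a)) x).dens n ≠ 0) ∧
      Filter.Tendsto (fun n : ℕ => (pivotContFract (muirRogersCoeff (wallisCoeff a)) x).convs n)
        Filter.atTop (nhds (wallisIntegral a x))) := by
  refine ⟨fun x hx => wallisIntegrand_integrableOn ha hx, fun x hx => wallisSeries_diverges ha hx,
    wallisIntegral_sub_sum_isBigO ha,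
    fun x hx => ⟨doubleIntegrand_integrableOn ha hx, wallisIntegral_eq_doubleIntegral a hx,
      fun s t _ _ => hasSum_wallisTerm a x s t,
      fun n => ⟨wallisTerm_integrableOn ha n, integral_wallisTerm ha n⟩⟩,
    muirRogersDet_wallisCoeff_ne_zero ha, muirRogersCoeff_wallisCoeff_zero a, fun m hm => ?_,
    muirRogersCoeff_wallisCoeff_odd ha, formalPivotContFract_wallisCoeff ha,
    fun x hx => pivotContFract_wallisCoeff ha hx⟩
  obtain ⟨k, rfl⟩ := Nat.exists_eq_add_of_le' hm
  rw [mul_add, mul_one, muirRogersCoeff_wallisCoeff_even ha]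
  push_cast
  rfl
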